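/- Let $a,b,c,n$ be integers with $n\ge 2$ and $n\nmid a$. Put $d=b^2-4ac$, $r=\gcd(a,n)$, let $k$ be the multiplicity of $2$ in $n/r$, and put $m=n/(2^k r)$ and $\delta=\gcd(m,r)$. Call an integer $u$ a quadratic residue of a positive integer $v$ if $x^2\equiv u \pmod v$ is solvable in integers (coprimality is not required), and a non-residue otherwise. We say that the intermediate quadratic formula (IQF) is valid for $ax^2+bx+c\equiv 0 \pmod n$ if its integer solutions $x$ are exactly the integers $x$ for which $2ax\equiv -b+s \pmod n$ for some integer $s$ with $s^2\equiv d \pmod n$. For a prime $p$ and positive integers $\alpha,\beta$, we say that $(p^\alpha,p^\beta)$ forms a $(b,d)$-obstruction if one of the following holds: - $p^\alpha\nmid d$, the multiplicity of $p$ in $d$ is an even number $2\mu$, and, writing $d=d_1p^{2\mu}$, one has $\sigma p^{\mu}+ip^{\alpha-\mu}\not\equiv b \pmod{p^\beta}$ for all integers $\sigma$ with $0\le\sigma<p^{\alpha-2\mu}$ and $\sigma^2\equiv d_1 \pmod{p^{\alpha-2\mu}}$ and all $i\in\{0,1,\dots,p^\mu-1\}$; - $p^\alpha\mid d$ and, writing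 $\alpha=2s$ or $\alpha=2s-1$ according to the parity of $\alpha$, one has $ip^s\not\equiv b \pmod{p^\beta}$ for all $i\in\{0,1,\dots,p^{\alpha-s}-1\}$. **Theorem.** The IQF is valid for $ax^2+bx+c\equiv 0 \pmod n$ if and only if either (a) $d$ is a quadratic non-residue of $n$, or (b) $d$ is a quadratic residue of $n$ and exactly one of the following conditions holds: (i) there is a prime factor $p$ of $2a$ such that, if $\beta$ is the multiplicity of $p$ in $2a$ and $\alpha$ is the multiplicity of $p$ in $4am$ (if $k\in\{0,1,2\}$) or in $2^kam$ (if $k\ge 3$), then $1<\beta<\alpha$, $p\mid b$, $p^2\mid d$, and $(p^\alpha,p^\beta)$ forms a $(b,d)$-obstruction; (ii) $k=0$, $r\mid b$, $r\mid c$, $d/r^2$ is a quadratic residue of $m$, and either $\delta=1$ or $\delta$ is a product of distinct odd primes $p_1,\dots,p_t$ such that each $p_i$ has even multiplicity $m_i$ in $m$ and $p_1^{m_1}\cdots p_t^{m_t}$ divides $d/r^2$; (iii) $k=1$, $r\mid b$, $r\mid c$, $b/r$ is odd, $a/r$ or $c/r$ is even, and $d/r^2$ and $\delta$ satisfy the conditions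 imposed on them in (ii); (iv) $k\ge 3$, $r$ and $k$ are odd, $r\mid b$, $r\mid c$, $k-1$ is the multiplicity of $2$ in $d/r^2$, $d/(r^2 2^{k-1})\equiv 1 \pmod 8$, and $d/r^2$ and $\delta$ satisfy the conditions imposed on them in (ii). Moreover, the conditions (i)–(iv) are mutually exclusive. -/

import Mathlib

namespace IQF

/-- `u` is a quadratic residue of `n`: the congruence `x ^ 2 ≡ u mod n` is solvable in integers.
(Coprimality of `u` and `n` is not required.) -/
def IsQuadRes (n : ℕ) (u : ℤ) : Prop :=
  ∃ x : ℤ, x ^ 2 ≡ u [ZMOD (n : ℤ)]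

/-- The intermediate quadratic formula is valid for `a x ^ 2 + b x + c ≡ 0 mod n`: the solutions `x`
of this congruence are exactly the solutions of `2 a x ≡ -b + s mod n`, where `s` runs over the
solutions of `s ^ 2 ≡ b ^ 2 - 4 a c mod n`. -/
def Valid (a b c : ℤ) (n : ℕ) : Prop :=
  ∀ x : ℤ, a * x ^ 2 + b * x + c ≡ 0 [ZMOD (n : ℤ)] ↔
    ∃ s : ℤ, s ^ 2 ≡ b ^ 2 - 4 * a * c [ZMOD (n : ℤ)] ∧ 2 * a * x ≡ -b + s [ZMOD (n : ℤ)]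

/-- The solutions of `x ^ 2 ≡ u mod v` that are nonnegative and minimal with respect to `v`. -/
def sqrtSols (u : ℤ) (v : ℕ) : Set ℤ :=
  {σ | 0 ≤ σ ∧ σ < (v : ℤ) ∧ σ ^ 2 ≡ u [ZMOD (v : ℤ)]}

/-- `(p ^ α, p ^ β)` forms a `(b, d)`-obstruction, the case in which `p ^ α` does not divide `d`.
Here `2 μ` is the multiplicity of `p` in `d` and `d = d₁ p ^ (2 μ)`. -/
def ObstructionNotDvd (p α β : ℕ) (b d : ℤ) : Prop :=
  ¬ (p : ℤ) ^ α ∣ d ∧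
    ∃ (μ : ℕ) (d₁ : ℤ), d = d₁ * (p : ℤ) ^ (2 * μ) ∧ ¬ (p : ℤ) ∣ d₁ ∧
      ∀ σ ∈ sqrtSols d₁ (p ^ (α - 2 * μ)), ∀ i : ℕ, i < p ^ μ →
        ¬ (σ * (p : ℤ) ^ μ + (i : ℤ) * (p : ℤ) ^ (α - μ) ≡ b [ZMOD (p : ℤ) ^ β])

/-- `(p ^ α, p ^ β)` forms a `(b, d)`-obstruction, the case in which `p ^ α` divides `d`.
Here `α = 2 s` or `α = 2 s - 1`. -/
def ObstructionDvd (p α β : ℕ) (b d : ℤ) : Prop :=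
  (p : ℤ) ^ α ∣ d ∧
    ∃ s : ℕ, (α = 2 * s ∨ α + 1 = 2 * s) ∧
      ∀ i : ℕ, i < p ^ (α - s) → ¬ ((i : ℤ) * (p : ℤ) ^ s ≡ b [ZMOD (p : ℤ) ^ β])

/-- `(p ^ α, p ^ β)` forms a `(b, d)`-obstruction. -/
def Obstruction (p α β : ℕ) (b d : ℤ) : Prop :=
  ObstructionNotDvd p α β b d ∨ ObstructionDvd p α β b d

/-- There is a prime factor `p` of `2 a` such that, with `β` the multiplicity of `p` in `2 a` and
`α` the multiplicity of `p` in `4 a m` (if `k ≤ 2`) or in `2 ^ k a m` (if `k ≥ 3`), one has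
`1 < β < α`, `p ∣ b`, `p ^ 2 ∣ d`, and `(p ^ α, p ^ β)` forms a `(b, d)`-obstruction. -/
def CondI (a b d : ℤ) (k m : ℕ) : Prop :=
  ∃ p : ℕ, p.Prime ∧ (p : ℤ) ∣ 2 * a ∧
    ∃ α β : ℕ, β = padicValInt p (2 * a) ∧
      α = (if k ≤ 2 then padicValInt p (4 * a * (m : ℤ))
        else padicValInt p (2 ^ k * a * (m : ℤ))) ∧
      1 < β ∧ β < α ∧ (p : ℤ) ∣ b ∧ (p : ℤ) ^ 2 ∣ d ∧ Obstruction p α β b d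

/-- The conditions on `D = d / r ^ 2` and `δ`: `D` is a quadratic residue of `m`, and either `δ = 1`
or `δ` is the product of distinct odd primes, each of even multiplicity in `m`, such that the
product of the corresponding prime powers in `m` divides `D`. -/
def DeltaCond (D : ℤ) (m δ : ℕ) : Prop :=
  IsQuadRes m D ∧
    (δ = 1 ∨ ∃ P : Finset ℕ, (∀ p ∈ P, p.Prime ∧ Odd p) ∧ δ = ∏ p ∈ P, p ∧
      (∀ p ∈ P, Even (padicValNat p m)) ∧ (∏ p ∈ P, (p : ℤ) ^ padicValNat p m) ∣ D)

/-- The condition for `k = 0`. -/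
def CondII (b c d : ℤ) (r k m δ : ℕ) : Prop :=
  k = 0 ∧ (r : ℤ) ∣ b ∧ (r : ℤ) ∣ c ∧ DeltaCond (d / (r : ℤ) ^ 2) m δ

/-- The condition for `k = 1`. -/
def CondIII (a b c d : ℤ) (r k m δ : ℕ) : Prop :=
  k = 1 ∧ (r : ℤ) ∣ b ∧ (r : ℤ) ∣ c ∧ Odd (b / (r : ℤ)) ∧
    (Even (a / (r : ℤ)) ∨ Even (c / (r : ℤ))) ∧ DeltaCond (d / (r : ℤ) ^ 2) m δ

/-- The condition for odd `k ≥ 3`. -/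
def CondIV (b c d : ℤ) (r k m δ : ℕ) : Prop :=
  3 ≤ k ∧ Odd r ∧ Odd k ∧ (r : ℤ) ∣ b ∧ (r : ℤ) ∣ c ∧
    k - 1 = padicValInt 2 (d / (r : ℤ) ^ 2) ∧
    d / ((r : ℤ) ^ 2 * 2 ^ (k - 1)) ≡ 1 [ZMOD 8] ∧ DeltaCond (d / (r : ℤ) ^ 2) m δ

/-- Exactly one of four propositions holds. -/
def ExactlyOne (A B C D : Prop) : Prop :=
  (A ∧ ¬ B ∧ ¬ C ∧ ¬ D) ∨ (¬ A ∧ B ∧ ¬ C ∧ ¬ D) ∨ (¬ A ∧ ¬ B ∧ C ∧ ¬ D) ∨ (¬ A ∧ ¬ B ∧ ¬ C ∧ D)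

/-- No two of four propositions hold together. -/
def MutuallyExclusive (A B C D : Prop) : Prop :=
  ¬ (A ∧ B) ∧ ¬ (A ∧ C) ∧ ¬ (A ∧ D) ∧ ¬ (B ∧ C) ∧ ¬ (B ∧ D) ∧ ¬ (C ∧ D)

end IQF

/-!
Write `f x = a * x ^ 2 + b * x + c`, so that `4 * a * f x = (2 * a * x + b) ^ 2 - d`. Validity of the
intermediate quadratic formula says that `n ∣ 4 * a * f x` implies `n ∣ f x` (`valid_iff`). With
`n = r * (2 ^ k * m)` and `a = r * a'`, where `a'` is coprime to `2 ^ k * m`, the divisibility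
`n ∣ 4 * a * f x` means `M ∣ f x` for `M = 2 ^ (k - 2) * m`, with truncated subtraction in the
exponent (`mul_dvd_four_mul_iff`). If `d` is a non-residue of `n`, no `x` satisfies it. Otherwise the
formula is valid in two cases: either `f` has no root modulo `M`, or it has one and all its roots
modulo `M` are roots modulo `n`.

The first case is `CondI`. A root of `f` modulo `M` amounts to a `y` with `y ^ 2 ≡ d` modulo
`4 * a * M` and `y ≡ b` modulo `2 * a`, which can be sought one prime at a time. There is
one by Hensel lifting when `p` divides `a` but not `b`, and because `d` is a square modulo `n` when
`p ^ 2 ∤ 2 * a`; in the remaining cases the list of all square roots of `d` modulo `p ^ α` shows that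
it exists unless there is an obstruction (`CondI.not_dvd`, `exists_dvd_of_not_condI`).

The second case is the disjunction of `CondII`, `CondIII` and `CondIV` (`cond_iff`). Comparing a root
`x` with `x + M` gives `r ∣ b` and `r ∣ c`, so `f = r * g`, and the requirement becomes: `g` satisfies
`r * g x ≡ 0` modulo `M` for some `x`, and all such `x` are roots of `g` modulo `2 ^ k * m`. This is the
predicate `Lifts`, which splits by the Chinese remainder theorem (`lifts_mul_iff`). At the odd
modulus `m`, completing the square turns `g` into `y ^ 2 - D`, and shifting roots gives the conditions
on `D` and `δ` (`deltaCond_iff_lifts`). At `2`, the requirement is empty for `k = 0`, a matter of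
parity for `k = 1`, impossible for `k = 2`, and for `k ≥ 3` it is settled by a descent that halves
square roots (`lifts_two_pow_quadratic_iff`).
-/

namespace IQF

/-! ### Passing from roots modulo `M` to roots modulo `N` -/

/-- `Lifts r f M N`: the congruence `r * f x ≡ 0 mod M` is solvable, and each of its solutions
satisfies `f x ≡ 0 mod N`. Solvability is part of the notion so that it localizes at coprime factors
of the moduli. -/
def Lifts (r : ℤ) (f : ℤ → ℤ) (M N : ℤ) : Prop :=
  (∃ x, M ∣ r * f x) ∧ ∀ x, M ∣ r * f x → N ∣ f x

theorem exists_dvd_sub_of_isCoprime {A B : ℤ} (h : IsCoprime A B) (x y : ℤ) :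
    ∃ z, A ∣ z - x ∧ B ∣ z - y := by
  obtain ⟨u, v, huv⟩ := h
  refine ⟨x * (v * B) + y * (u * A), ⟨u * (y - x), ?_⟩, ⟨v * (x - y), ?_⟩⟩
  · linear_combination x * huv
  · linear_combination y * huv

theorem exists_dvd_mul_add_sub {A N : ℤ} (h : IsCoprime A N) (B y : ℤ) :
    ∃ x, N ∣ A * x + B - y := by
  obtain ⟨u, v, huv⟩ := h
  exact ⟨u * (y - B), -v * (y - B), by linear_combination (y - B) * huv⟩

theorem sub_dvd_quadratic_sub (a b c x y : ℤ) :
    x - y ∣ (a * x ^ 2 + b * x + c) - (a * y ^ 2 + b * y + c) :=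
  ⟨a * (x + y) + b, by ring⟩

theorem sub_dvd_sq_sub (D x y : ℤ) : x - y ∣ (x ^ 2 - D) - (y ^ 2 - D) :=
  ⟨x + y, by ring⟩

theorem dvd_of_dvd_sub_of_dvd {f : ℤ → ℤ} (hf : ∀ x y, x - y ∣ f x - f y) {N x y : ℤ}
    (h : N ∣ x - y) (hx : N ∣ f x) : N ∣ f y := by
  have h1 := h.trans (hf x y)
  exact (dvd_sub_right hx).1 h1

theorem dvd_mul_of_dvd_sub_of_dvd {f : ℤ → ℤ} (hf : ∀ x y, x - y ∣ f x - f y) {r N x y : ℤ}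
    (h : N ∣ x - y) (hx : N ∣ r * f x) : N ∣ r * f y :=
  dvd_of_dvd_sub_of_dvd (f := fun x => r * f x)
    (fun x y => by rw [← mul_sub]; exact (hf x y).mul_left r) h hx

/-- Chinese remainder theorem for `Lifts`. -/
theorem lifts_mul_iff {r : ℤ} {f : ℤ → ℤ} (hf : ∀ x y, x - y ∣ f x - f y) {M₁ M₂ N₁ N₂ : ℤ}
    (h₁ : M₁ ∣ N₁) (h₂ : M₂ ∣ N₂) (h : IsCoprime N₁ N₂) :
    Lifts r f (M₁ * M₂) (N₁ * N₂) ↔ Lifts r f M₁ N₁ ∧ Lifts r f M₂ N₂ := by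
  have hM : IsCoprime M₁ M₂ := (h.of_isCoprime_of_dvd_left h₁).of_isCoprime_of_dvd_right h₂
  constructor
  · rintro ⟨⟨x₀, hx₀⟩, hl⟩
    have h10 := (dvd_mul_right M₁ M₂).trans hx₀
    have h20 := (dvd_mul_left M₂ M₁).trans hx₀
    refine ⟨⟨⟨x₀, h10⟩, fun x hx => ?_⟩, ⟨⟨x₀, h20⟩, fun x hx => ?_⟩⟩
    · obtain ⟨z, hz1, hz2⟩ := exists_dvd_sub_of_isCoprime h x x₀
      have := hl z (hM.mul_dvd
        (dvd_mul_of_dvd_sub_of_dvd hf ((dvd_sub_comm).1 (h₁.trans hz1)) hx)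
        (dvd_mul_of_dvd_sub_of_dvd hf ((dvd_sub_comm).1 (h₂.trans hz2)) h20))
      exact dvd_of_dvd_sub_of_dvd hf hz1 ((dvd_mul_right _ _).trans this)
    · obtain ⟨z, hz1, hz2⟩ := exists_dvd_sub_of_isCoprime h x₀ x
      have := hl z (hM.mul_dvd
        (dvd_mul_of_dvd_sub_of_dvd hf ((dvd_sub_comm).1 (h₁.trans hz1)) h10)
        (dvd_mul_of_dvd_sub_of_dvd hf ((dvd_sub_comm).1 (h₂.trans hz2)) hx))
      exact dvd_of_dvd_sub_of_dvd hf hz2 ((dvd_mul_left _ _).trans this)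
  · rintro ⟨⟨⟨x₁, hx₁⟩, hl₁⟩, ⟨⟨x₂, hx₂⟩, hl₂⟩⟩
    refine ⟨?_, fun x hx => h.mul_dvd (hl₁ x ((dvd_mul_right _ _).trans hx))
      (hl₂ x ((dvd_mul_left _ _).trans hx))⟩
    obtain ⟨z, hz1, hz2⟩ := exists_dvd_sub_of_isCoprime h x₁ x₂
    exact ⟨z, hM.mul_dvd
      (dvd_mul_of_dvd_sub_of_dvd hf ((dvd_sub_comm).1 (h₁.trans hz1)) hx₁)
      (dvd_mul_of_dvd_sub_of_dvd hf ((dvd_sub_comm).1 (h₂.trans hz2)) hx₂)⟩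

/-- Completing the square: if `w * f x = (A * x + B) ^ 2 - E` with `w` and `A` invertible modulo
`N`, then `f` may be replaced by `y ^ 2 - E` in `Lifts`. -/
theorem lifts_iff_lifts_sq_sub {r w A B E M N : ℤ} {f : ℤ → ℤ}
    (hf : ∀ x, w * f x = (A * x + B) ^ 2 - E) (hw : IsCoprime w N) (hA : IsCoprime A N)
    (hMN : M ∣ N) :
    Lifts r f M N ↔ Lifts r (fun y => y ^ 2 - E) M N := by
  have hwM := hw.of_isCoprime_of_dvd_right hMN
  have key : ∀ x, M ∣ r * f x ↔ M ∣ r * ((A * x + B) ^ 2 - E) := fun x => by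
    rw [← hf, mul_left_comm]
    exact ⟨fun h => h.mul_left _, fun h => hwM.symm.dvd_of_dvd_mul_left h⟩
  have key' : ∀ x, N ∣ f x ↔ N ∣ (A * x + B) ^ 2 - E := fun x => by
    rw [← hf]
    exact ⟨fun h => h.mul_left _, fun h => hw.symm.dvd_of_dvd_mul_left h⟩
  constructor
  · rintro ⟨⟨x, hx⟩, hl⟩
    refine ⟨⟨A * x + B, (key x).1 hx⟩, fun y hy => ?_⟩
    obtain ⟨x, hx⟩ := exists_dvd_mul_add_sub hA B y
    refine dvd_of_dvd_sub_of_dvd (sub_dvd_sq_sub E) hx ((key' x).1 (hl x ((key x).2 ?_)))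
    exact dvd_mul_of_dvd_sub_of_dvd (sub_dvd_sq_sub E) (dvd_sub_comm.1 (hMN.trans hx)) hy
  · rintro ⟨⟨y, hy⟩, hl⟩
    refine ⟨?_, fun x hx => (key' x).2 (hl _ ((key x).1 hx))⟩
    obtain ⟨x, hx⟩ := exists_dvd_mul_add_sub hA B y
    exact ⟨x, (key x).2
      (dvd_mul_of_dvd_sub_of_dvd (sub_dvd_sq_sub E) (dvd_sub_comm.1 (hMN.trans hx)) hy)⟩

/-! ### The condition at odd primes -/

/-- If `p ^ (2 * t - 1)` divides a square, its root is divisible by `p ^ t`. -/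
theorem pow_dvd_of_pow_dvd_sq {p : ℤ} (hp : Prime p) {t j : ℕ} (hj : 2 * t ≤ j + 1) {y : ℤ}
    (h : p ^ j ∣ y ^ 2) : p ^ t ∣ y := by
  induction t generalizing j y with
  | zero => simp
  | succ t ih =>
    obtain ⟨i, rfl⟩ : ∃ i, j = i + 1 := ⟨j - 1, by omega⟩
    have hpy : p ∣ y := hp.dvd_of_dvd_pow ((dvd_pow_self p (by omega)).trans h)
    obtain ⟨z, rfl⟩ := hpy
    rw [pow_succ, mul_comm]
    refine mul_dvd_mul_left p ?_
    rcases Nat.eq_zero_or_pos t with rfl | ht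
    · simp
    obtain ⟨l, rfl⟩ : ∃ l, i = l + 1 := ⟨i - 1, by omega⟩
    refine ih (j := l) (by omega) ?_
    rw [mul_pow, pow_succ, pow_succ, mul_assoc, ← sq, mul_comm] at h
    exact (mul_dvd_mul_iff_left (pow_ne_zero 2 hp.ne_zero)).1 h

/-- For an odd prime `p` dividing `r`, the hypothesis makes every root of `y ^ 2 - D` modulo
`p ^ (e - 1)` a root modulo `p ^ e`. If `p ^ e ∤ D`, a shift of a root contradicts this; if
`p ^ e ∣ D`, the powers of `p` do unless `e` is even and `p` divides `r` only once. -/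
theorem Lifts.prime_pow {p : ℕ} (hp : p.Prime) (hodd : p ≠ 2) {e : ℕ} (he : 1 ≤ e) {r D : ℤ}
    (hpr : (p : ℤ) ∣ r)
    (h : Lifts r (fun y => y ^ 2 - D) ((p : ℤ) ^ e) ((p : ℤ) ^ e)) :
    Even e ∧ (p : ℤ) ^ e ∣ D ∧ ¬ (p : ℤ) ^ 2 ∣ r := by
  have hpZ : Prime (p : ℤ) := Nat.prime_iff_prime_int.1 hp
  have hp0 : (p : ℤ) ≠ 0 := hpZ.ne_zero
  obtain ⟨⟨z₀, hz₀⟩, hl⟩ := h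
  obtain ⟨j, rfl⟩ : ∃ j, e = j + 1 := ⟨e - 1, by omega⟩
  have hl' : ∀ y : ℤ, (p : ℤ) ^ j ∣ y ^ 2 - D → (p : ℤ) ^ (j + 1) ∣ y ^ 2 - D := fun y hy =>
    hl y (by rw [pow_succ, mul_comm]; exact mul_dvd_mul hpr hy)
  have hz := hl z₀ hz₀
  dsimp only at hz
  have hD : (p : ℤ) ^ (j + 1) ∣ D := by
    by_contra hD
    have hz2 : ¬ (p : ℤ) ^ (j + 1) ∣ z₀ ^ 2 := fun h => hD ((dvd_sub_right h).1 hz)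
    have hz0 : z₀ ≠ 0 := by rintro rfl; simp at hz2
    obtain ⟨μ, w, hw, rfl⟩ := WfDvdMonoid.max_power_factor hz0 hpZ.irreducible
    have hμ : 2 * μ < j + 1 := by
      by_contra hc
      apply hz2
      rw [mul_pow, ← pow_mul]
      exact (pow_dvd_pow _ (by omega)).mul_right _
    obtain ⟨i, rfl⟩ : ∃ i, j = 2 * μ + i := ⟨j - 2 * μ, by omega⟩
    have hz' : (p : ℤ) ^ (2 * μ + i) ∣ ((p : ℤ) ^ μ * w) ^ 2 - D :=
      (pow_dvd_pow _ (by omega)).trans hz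
    -- the shifts of the root by `±p ^ (μ + i)` are roots modulo `p ^ (2 * μ + i)`, and their squares
    -- differ by `4 * w * p ^ (2 * μ + i)`
    have h1 := hl' ((p : ℤ) ^ μ * w + (p : ℤ) ^ (μ + i)) (by
      have : ((p : ℤ) ^ μ * w + (p : ℤ) ^ (μ + i)) ^ 2 - D =
        (((p : ℤ) ^ μ * w) ^ 2 - D) + (p : ℤ) ^ (2 * μ + i) * (2 * w + (p : ℤ) ^ i) := by ring
      rw [this]
      exact dvd_add hz' (dvd_mul_right _ _))
    have h2 := hl' ((p : ℤ) ^ μ * w - (p : ℤ) ^ (μ + i)) (by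
      have : ((p : ℤ) ^ μ * w - (p : ℤ) ^ (μ + i)) ^ 2 - D =
        (((p : ℤ) ^ μ * w) ^ 2 - D) + (p : ℤ) ^ (2 * μ + i) * (-2 * w + (p : ℤ) ^ i) := by ring
      rw [this]
      exact dvd_add hz' (dvd_mul_right _ _))
    have h3 := dvd_sub h1 h2
    have h4 : (p : ℤ) ^ (2 * μ + i) * p ∣ (p : ℤ) ^ (2 * μ + i) * (2 ^ 2 * w) := by
      rw [← pow_succ, show (p : ℤ) ^ (2 * μ + i) * (2 ^ 2 * w) =
        (((p : ℤ) ^ μ * w + (p : ℤ) ^ (μ + i)) ^ 2 - D) -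
          (((p : ℤ) ^ μ * w - (p : ℤ) ^ (μ + i)) ^ 2 - D) by ring]
      exact h3
    have h5 := (mul_dvd_mul_iff_left (pow_ne_zero _ hp0)).1 h4
    rcases hpZ.dvd_or_dvd h5 with h6 | h6
    · have h7 := hpZ.dvd_of_dvd_pow h6
      have h8 : p ∣ 2 := by exact_mod_cast h7
      exact hodd ((Nat.prime_dvd_prime_iff_eq hp Nat.prime_two).1 h8)
    · exact hw h6
  have hle : ∀ {i l : ℕ}, (p : ℤ) ^ i ∣ (p : ℤ) ^ l → i ≤ l := fun {i l} h =>
    (pow_dvd_pow_iff hp0 hpZ.not_isUnit).1 h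
  have heven : Even (j + 1) := by
    by_contra hne
    obtain ⟨t, ht⟩ := Nat.not_even_iff_odd.1 hne
    have h1 := hl' ((p : ℤ) ^ t) (dvd_sub (by rw [← pow_mul]; exact pow_dvd_pow _ (by omega))
      ((pow_dvd_pow _ (by omega)).trans hD))
    have h2 := (dvd_sub_left hD).1 h1
    rw [← pow_mul] at h2
    have := hle h2
    omega
  refine ⟨heven, hD, fun hr2 => ?_⟩
  obtain ⟨t, ht⟩ := heven
  have h1 := hl ((p : ℤ) ^ (t - 1)) (by
    have e1 : (p : ℤ) ^ (j + 1) = (p : ℤ) ^ 2 * (p : ℤ) ^ (2 * (t - 1)) := by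
      rw [← pow_add]; congr 1; omega
    dsimp only
    rw [e1]
    refine mul_dvd_mul hr2 (dvd_sub ?_ ((pow_dvd_pow _ (by omega)).trans hD))
    rw [← pow_mul, mul_comm])
  have h2 := (dvd_sub_left hD).1 h1
  rw [← pow_mul] at h2
  have := hle h2
  omega

theorem exists_eq_pow_padicValNat_mul {p m : ℕ} (hp : p.Prime) (hm : m ≠ 0) :
    ∃ m₀, m = p ^ padicValNat p m * m₀ ∧ ¬ p ∣ m₀ := by
  have := Fact.mk hp
  obtain ⟨m₀, h⟩ := pow_padicValNat_dvd (p := p) (n := m)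
  refine ⟨m₀, h, ?_⟩
  rintro ⟨m₁, rfl⟩
  apply pow_succ_padicValNat_not_dvd (p := p) hm
  exact ⟨m₁, by rw [pow_succ, mul_assoc]; exact h⟩

theorem int_dvd_of_forall_prime_pow_dvd {m : ℕ} {z : ℤ}
    (h : ∀ p j : ℕ, p.Prime → p ^ j ∣ m → (p : ℤ) ^ j ∣ z) : (m : ℤ) ∣ z := by
  refine Int.natCast_dvd.2 ((Nat.dvd_iff_prime_pow_dvd_dvd _ _).2 fun p j hp hpj => by
    have := h p j hp hpj
    rw [← Int.natCast_pow, Int.natCast_dvd] at this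
    exact this)

/-- `DeltaCond` says that `y ^ 2 ≡ D` is solvable modulo `m`, and that no solution of
`r * (y ^ 2 - D) ≡ 0 mod m` is spurious. -/
theorem deltaCond_iff_lifts {D : ℤ} {m r δ : ℕ} (hm0 : m ≠ 0) (hm : Odd m) (hδ : δ = Nat.gcd m r) :
    DeltaCond D m δ ↔ Lifts r (fun y => y ^ 2 - D) m m := by
  constructor
  · rintro ⟨⟨y₀, hy₀⟩, hδ'⟩
    refine ⟨⟨y₀, (Int.modEq_iff_dvd.1 hy₀.symm).mul_left _⟩, fun y hy => ?_⟩
    refine int_dvd_of_forall_prime_pow_dvd fun p j hp hpj => ?_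
    have := Fact.mk hp
    have hpZ : Prime (p : ℤ) := Nat.prime_iff_prime_int.1 hp
    rcases Nat.eq_zero_or_pos j with rfl | hj
    · simp
    have hpm : p ∣ m := (dvd_pow_self p hj.ne').trans hpj
    have hje : j ≤ padicValNat p m := (padicValNat_dvd_iff_le hm0).1 hpj
    refine (pow_dvd_pow _ hje).trans ?_
    have hy' : (p : ℤ) ^ padicValNat p m ∣ r * (y ^ 2 - D) :=
      (by exact_mod_cast pow_padicValNat_dvd : (p : ℤ) ^ padicValNat p m ∣ (m : ℤ)).trans hy
    by_cases hpr : p ∣ r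
    · have hpδ : p ∣ δ := hδ ▸ Nat.dvd_gcd hpm hpr
      rcases hδ' with rfl | ⟨P, hP, hPδ, hPe, hPD⟩
      · exact absurd (Nat.dvd_one.1 hpδ) hp.one_lt.ne'
      have hpP : p ∈ P := by
        rw [hPδ] at hpδ
        obtain ⟨q, hq, hpq⟩ := (Prime.dvd_finsetProd_iff hp.prime _).1 hpδ
        rwa [(Nat.prime_dvd_prime_iff_eq hp (hP q hq).1).1 hpq]
      obtain ⟨t, ht⟩ := hPe p hpP
      have hpD : (p : ℤ) ^ padicValNat p m ∣ D :=
        (Finset.dvd_prod_of_mem (fun p : ℕ => (p : ℤ) ^ padicValNat p m) hpP).trans hPD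
      have hp2 : ¬ p ^ 2 ∣ r := by
        intro hp2
        have h2m : p ^ 2 ∣ m := (padicValNat_dvd_iff_le hm0).2 (by omega)
        have h2δ : p ^ 2 ∣ δ := hδ ▸ Nat.dvd_gcd h2m hp2
        rw [hPδ, ← Finset.mul_prod_erase P _ hpP, sq] at h2δ
        have h3 := Nat.dvd_of_mul_dvd_mul_left hp.pos h2δ
        obtain ⟨q, hq, hpq⟩ := (Prime.dvd_finsetProd_iff hp.prime _).1 h3
        rw [Finset.mem_erase] at hq
        exact hq.1 ((Nat.prime_dvd_prime_iff_eq hp (hP q hq.2).1).1 hpq).symm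
      obtain ⟨r', rfl⟩ := hpr
      have hpr' : ¬ (p : ℤ) ∣ (r' : ℤ) := fun h => hp2 (by
        rw [sq]; exact mul_dvd_mul_left p (by exact_mod_cast h))
      have h1 : (p : ℤ) ^ padicValNat p m ∣ ((p * r' : ℕ) : ℤ) * y ^ 2 := by
        rw [show ((p * r' : ℕ) : ℤ) * y ^ 2 =
          ((p * r' : ℕ) : ℤ) * (y ^ 2 - D) + ((p * r' : ℕ) : ℤ) * D by ring]
        exact dvd_add hy' (hpD.mul_left _)
      obtain ⟨e, he⟩ : ∃ e, padicValNat p m = e + 1 := ⟨padicValNat p m - 1, by omega⟩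
      have h2 : (p : ℤ) ^ e ∣ r' * y ^ 2 := by
        rw [he, pow_succ, mul_comm] at h1
        push_cast at h1
        rw [mul_assoc] at h1
        exact (mul_dvd_mul_iff_left hpZ.ne_zero).1 h1
      have h3 := hpZ.pow_dvd_of_dvd_mul_left _ hpr' h2
      have h4 := pow_dvd_of_pow_dvd_sq hpZ (t := t) (by omega) h3
      refine dvd_sub ?_ hpD
      rw [ht, ← two_mul, mul_comm, pow_mul]
      exact pow_dvd_pow_of_dvd h4 2
    · exact hpZ.pow_dvd_of_dvd_mul_left _ (by exact_mod_cast hpr) hy'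
  · intro h
    obtain ⟨y₀, hy₀⟩ := h.1
    refine ⟨⟨y₀, (Int.modEq_iff_dvd.2 (h.2 y₀ hy₀)).symm⟩, Or.inr ⟨δ.primeFactors, ?_⟩⟩
    have hδ0 : δ ≠ 0 := by rw [hδ]; exact Nat.gcd_ne_zero_left hm0
    have key : ∀ p : ℕ, p.Prime → p ∣ δ → Odd p ∧ Even (padicValNat p m) ∧
        (p : ℤ) ^ padicValNat p m ∣ D ∧ ¬ (p : ℤ) ^ 2 ∣ r := by
      intro p hp hpδ
      have := Fact.mk hp
      have hpm : p ∣ m := hpδ.trans (hδ ▸ Nat.gcd_dvd_left _ _)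
      have hpr : p ∣ r := hpδ.trans (hδ ▸ Nat.gcd_dvd_right _ _)
      have hpo : Odd p := Odd.of_dvd_nat hm hpm
      refine ⟨hpo, ?_⟩
      obtain ⟨m₀, hm₀, hpm₀⟩ := exists_eq_pow_padicValNat_mul hp hm0
      have he : 1 ≤ padicValNat p m := one_le_padicValNat_of_dvd hm0 hpm
      have hmZ : (m : ℤ) = (p : ℤ) ^ padicValNat p m * m₀ := by exact_mod_cast hm₀
      have hl : Lifts r (fun y => y ^ 2 - D) ((p : ℤ) ^ padicValNat p m * m₀)
          ((p : ℤ) ^ padicValNat p m * m₀) := hmZ ▸ h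
      have hc : IsCoprime ((p : ℤ) ^ padicValNat p m) (m₀ : ℤ) :=
        (Nat.isCoprime_iff_coprime.2 ((Nat.Prime.coprime_iff_not_dvd hp).2 hpm₀)).pow_left
      have hl' := ((lifts_mul_iff (sub_dvd_sq_sub D) dvd_rfl dvd_rfl hc).1 hl).1
      refine hl'.prime_pow hp ?_ he (by exact_mod_cast hpr)
      rintro rfl
      exact absurd hpo (by decide)
    refine ⟨fun p hp => ⟨Nat.prime_of_mem_primeFactors hp,
      (key p (Nat.prime_of_mem_primeFactors hp) (Nat.dvd_of_mem_primeFactors hp)).1⟩, ?_,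
      fun p hp => (key p (Nat.prime_of_mem_primeFactors hp) (Nat.dvd_of_mem_primeFactors hp)).2.1,
      ?_⟩
    · refine (Nat.prod_primeFactors_of_squarefree ?_).symm
      refine Nat.squarefree_iff_prime_squarefree.2 fun p hp hpp => ?_
      refine (key p hp ((dvd_mul_right p p).trans hpp)).2.2.2 ?_
      have : p * p ∣ r := hpp.trans (hδ ▸ Nat.gcd_dvd_right _ _)
      rw [sq]
      exact_mod_cast this
    · refine Finset.prod_dvd_of_coprime (fun p hp q hq hpq => ?_) fun p hp =>
        (key p (Nat.prime_of_mem_primeFactors hp) (Nat.dvd_of_mem_primeFactors hp)).2.2.1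
      exact (Nat.isCoprime_iff_coprime.2 ((Nat.coprime_primes (Nat.prime_of_mem_primeFactors hp)
        (Nat.prime_of_mem_primeFactors hq)).2 hpq)).pow

/-! ### Lifting square roots modulo powers of `2` -/

theorem eight_dvd_sq_sub_one {y : ℤ} (h : ¬ 2 ∣ y) : 8 ∣ y ^ 2 - 1 := by
  obtain ⟨t, rfl⟩ : ∃ t, y = 2 * t + 1 := ⟨y / 2, by omega⟩
  obtain ⟨s, hs⟩ := (Int.even_mul_succ_self t).two_dvd
  exact ⟨s, by linear_combination 4 * hs⟩

theorem dvd_four_mul_iff (K : ℕ) (z E : ℤ) :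
    2 ^ (K + 2) ∣ (2 * z) ^ 2 - 4 * E ↔ 2 ^ K ∣ z ^ 2 - E := by
  rw [show (2 : ℤ) ^ (K + 2) = 4 * 2 ^ K by ring,
    show (2 * z) ^ 2 - 4 * E = 4 * (z ^ 2 - E) by ring]
  exact mul_dvd_mul_iff_left (by norm_num)

/-- Roots of `y ^ 2 - E` modulo `2 ^ K` are never all roots modulo `2 ^ (K + 3)`.
For `K ≥ 2` they would have to be even, and halving them lowers `K` by `2`. -/
theorem not_lifts_two_pow_add_three (K : ℕ) (E : ℤ) :
    ¬ Lifts 1 (fun y => y ^ 2 - E) (2 ^ K) (2 ^ (K + 3)) := by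
  induction K using Nat.strong_induction_on generalizing E with
  | _ K ih =>
    rintro ⟨⟨y, hy⟩, hl⟩
    simp only [one_mul] at hy hl
    have h0 := hl y hy
    have h1 := hl (y + 2 ^ K) (by
      rw [show (y + 2 ^ K) ^ 2 - E = (y ^ 2 - E) + 2 ^ K * (2 * y + 2 ^ K) by ring]
      exact dvd_add hy (dvd_mul_right _ _))
    have h2 : (2 : ℤ) ^ K * 8 ∣ 2 ^ K * (2 * y + 2 ^ K) := by
      rw [show (2 : ℤ) ^ K * (2 * y + 2 ^ K) = ((y + 2 ^ K) ^ 2 - E) - (y ^ 2 - E) by ring,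
        show (2 : ℤ) ^ K * 8 = 2 ^ (K + 3) by ring]
      exact dvd_sub h1 h0
    have h3 := (mul_dvd_mul_iff_left (by positivity)).1 h2
    match K, ih, hl, hy, h0, h3 with
    | 0, _, _, _, _, h3 =>
      rw [pow_zero] at h3
      omega
    | 1, _, hl, hy, h0, h3 =>
      have h4 := hl (y - 2) (by
        rw [show (y - 2) ^ 2 - E = (y ^ 2 - E) + 2 ^ 1 * (2 - 2 * y) by ring]
        exact dvd_add hy (dvd_mul_right _ _))
      have e2 : (y - 2) ^ 2 = y ^ 2 - 4 * y + 4 := by ring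
      norm_num at h0 h4 h3
      omega
    | K + 2, ih, hl, hy, h0, h3 =>
      have hy2 : 2 ∣ y := by
        rw [show (2 : ℤ) ^ (K + 2) = 4 * 2 ^ K by ring] at h3
        omega
      obtain ⟨z, rfl⟩ := hy2
      obtain ⟨E', rfl⟩ : 4 ∣ E := by
        have h4 : (4 : ℤ) ∣ (2 * z) ^ 2 - E := (Dvd.intro (2 ^ K) (by ring)).trans hy
        exact (dvd_sub_right (Dvd.intro (z ^ 2) (by ring))).1 h4
      refine ih K (by omega) E' ⟨⟨z, ?_⟩, fun w hw => ?_⟩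
      · rw [one_mul]
        exact (dvd_four_mul_iff K z E').1 hy
      · rw [one_mul] at hw
        exact (dvd_four_mul_iff (K + 3) w E').1 (hl _ ((dvd_four_mul_iff K w E').2 hw))

/-- Roots of `y ^ 2 - E` modulo `2 ^ (K + 1)` are all roots modulo `2 ^ (K + 3)` exactly when
`K` is even and `E = 2 ^ K * u` with `u ≡ 1 mod 8`. For `K ≥ 2` all roots are even, and halving them
lowers `K` by `2`. -/
theorem lifts_two_pow_iff (K : ℕ) (E : ℤ) :
    Lifts 1 (fun y => y ^ 2 - E) (2 ^ (K + 1)) (2 ^ (K + 3)) ↔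
      Even K ∧ ∃ u : ℤ, u ≡ 1 [ZMOD 8] ∧ E = 2 ^ K * u := by
  induction K using Nat.strong_induction_on generalizing E with
  | _ K ih =>
    constructor
    · rintro ⟨⟨y, hy⟩, hl⟩
      simp only [one_mul] at hy hl
      have h0 := hl y hy
      match K, ih, hl, hy, h0 with
      | 0, _, hl, hy, h0 =>
        have h1 := hl (y + 2) (by
          rw [show (y + 2) ^ 2 - E = (y ^ 2 - E) + 2 ^ (0 + 1) * (2 * y + 2) by ring]
          exact dvd_add hy (dvd_mul_right _ _))
        have h2 : (8 : ℤ) ∣ 4 * y + 4 := by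
          rw [show 4 * y + 4 = ((y + 2) ^ 2 - E) - (y ^ 2 - E) by ring]
          exact dvd_sub h1 h0
        have h3 := eight_dvd_sq_sub_one (y := y) (by omega)
        refine ⟨by decide, E, ?_, by ring⟩
        norm_num at h0
        exact Int.ModEq.symm (Int.modEq_iff_dvd.2 (by omega))
      | 1, _, hl, hy, h0 =>
        exfalso
        have h1 := hl (y + 2) (by
          rw [show (y + 2) ^ 2 - E = (y ^ 2 - E) + 2 ^ (1 + 1) * (y + 1) by ring]
          exact dvd_add hy (dvd_mul_right _ _))
        have h2 := hl (y - 2) (by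
          rw [show (y - 2) ^ 2 - E = (y ^ 2 - E) + 2 ^ (1 + 1) * (1 - y) by ring]
          exact dvd_add hy (dvd_mul_right _ _))
        norm_num at h0 h1 h2
        have e1 : (y + 2) ^ 2 = y ^ 2 + 4 * y + 4 := by ring
        have e2 : (y - 2) ^ 2 = y ^ 2 - 4 * y + 4 := by ring
        omega
      | K + 2, ih, hl, hy, h0 =>
        have h1 := hl (y + 2 ^ (K + 2)) (by
          rw [show (y + 2 ^ (K + 2)) ^ 2 - E =
            (y ^ 2 - E) + 2 ^ (K + 2 + 1) * (y + 2 ^ (K + 1)) by ring]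
          exact dvd_add hy (dvd_mul_right _ _))
        have h2 : (2 : ℤ) ^ (K + 3) * 4 ∣ 2 ^ (K + 3) * (y + 2 * 2 ^ K) := by
          rw [show (2 : ℤ) ^ (K + 3) * (y + 2 * 2 ^ K) =
            ((y + 2 ^ (K + 2)) ^ 2 - E) - (y ^ 2 - E) by ring,
            show (2 : ℤ) ^ (K + 3) * 4 = 2 ^ (K + 2 + 3) by ring]
          exact dvd_sub h1 h0
        have h3 := (mul_dvd_mul_iff_left (by positivity)).1 h2
        obtain ⟨z, rfl⟩ : 2 ∣ y := by omega
        obtain ⟨E', rfl⟩ : 4 ∣ E := by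
          have h4 : (4 : ℤ) ∣ (2 * z) ^ 2 - E := (Dvd.intro (2 ^ (K + 1)) (by ring)).trans hy
          exact (dvd_sub_right (Dvd.intro (z ^ 2) (by ring))).1 h4
        obtain ⟨hK, u, hu, hE⟩ := (ih K (by omega) E').1 ⟨⟨z, by
          rw [one_mul]; exact (dvd_four_mul_iff (K + 1) z E').1 hy⟩, fun w hw => by
            rw [one_mul] at hw
            exact (dvd_four_mul_iff (K + 3) w E').1
              (hl _ ((dvd_four_mul_iff (K + 1) w E').2 hw))⟩
        exact ⟨by rw [Nat.even_add]; simpa using hK, u, hu, by rw [hE]; ring⟩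
    · rintro ⟨hK, u, hu, rfl⟩
      match K, ih, hK with
      | 0, _, _ =>
        have hu' := Int.modEq_iff_dvd.1 hu
        refine ⟨⟨1, ?_⟩, fun y hy => ?_⟩
        · norm_num
          omega
        · norm_num at hy ⊢
          have h2 : ¬ 2 ∣ y := fun h => by
            have := h.mul_right y
            rw [← sq] at this
            omega
          have := eight_dvd_sq_sub_one h2
          omega
      | 1, _, hK => exact absurd hK (by decide)
      | K + 2, ih, hK =>
        have hK' : Even K := by rw [Nat.even_add] at hK; simpa using hK
        rw [show (2 : ℤ) ^ (K + 2) * u = 4 * (2 ^ K * u) by ring]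
        obtain ⟨⟨z, hz⟩, hl⟩ := (ih K (by omega) _).2 ⟨hK', u, hu, rfl⟩
        simp only [one_mul] at hz hl
        refine ⟨⟨2 * z, by rw [one_mul]; exact (dvd_four_mul_iff (K + 1) z _).2 hz⟩,
          fun y hy => ?_⟩
        rw [one_mul] at hy
        have h4 : (2 : ℤ) ∣ y ^ 2 - 4 * (2 ^ K * u) :=
          (Dvd.intro (2 ^ (K + 2)) (by ring)).trans hy
        obtain ⟨w, rfl⟩ := Int.prime_two.dvd_of_dvd_pow
          ((dvd_sub_left (Dvd.intro (2 * (2 ^ K * u)) (by ring))).1 h4)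
        exact (dvd_four_mul_iff (K + 3) w _).2 (hl w ((dvd_four_mul_iff (K + 1) w _).1 hy))

/-! ### Solvability of the quadratic congruence and obstructions -/

/-- Modulo `p` the quadratic is linear and nonconstant, so Hensel lifting provides roots. -/
theorem exists_pow_dvd_quadratic {p a b : ℤ} (hp : Prime p) (ha : p ∣ a) (hb : ¬ p ∣ b) (c : ℤ)
    (j : ℕ) : ∃ x, p ^ j ∣ a * x ^ 2 + b * x + c := by
  induction j with
  | zero => exact ⟨0, by simp⟩
  | succ j ih =>
    obtain ⟨x, q, hq⟩ := ih
    obtain ⟨a', rfl⟩ := ha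
    have hcop : IsCoprime b p := ((Prime.coprime_iff_not_dvd hp).2 hb).symm
    obtain ⟨t, s, hs⟩ := exists_dvd_mul_add_sub hcop q 0
    refine ⟨x + p ^ j * t, 2 * a' * x * t + s + a' * t ^ 2 * p ^ j, ?_⟩
    linear_combination hq + p ^ j * hs

/-- A congruence for an integer polynomial function is solvable if it is solvable modulo all prime
powers dividing the modulus. -/
theorem exists_dvd_of_forall_prime_pow {f : ℤ → ℤ} (hf : ∀ x y, x - y ∣ f x - f y) (N : ℕ)
    (hN : N ≠ 0) (h : ∀ p j : ℕ, p.Prime → p ^ j ∣ N → ∃ x, (p : ℤ) ^ j ∣ f x) :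
    ∃ x, (N : ℤ) ∣ f x := by
  induction N using Nat.recOnPosPrimePosCoprime with
  | prime_pow p j hp hj => simpa using h p j hp dvd_rfl
  | zero => exact absurd rfl hN
  | one => exact ⟨0, by simp⟩
  | coprime A B hA hB hAB ihA ihB =>
    obtain ⟨x, hx⟩ := ihA (by omega) fun p j hp hj => h p j hp (hj.mul_right _)
    obtain ⟨y, hy⟩ := ihB (by omega) fun p j hp hj => h p j hp (hj.mul_left _)
    have hc := Nat.isCoprime_iff_coprime.2 hAB
    obtain ⟨z, hz1, hz2⟩ := exists_dvd_sub_of_isCoprime hc x y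
    refine ⟨z, ?_⟩
    rw [Nat.cast_mul]
    exact hc.mul_dvd (dvd_of_dvd_sub_of_dvd hf (dvd_sub_comm.1 hz1) hx)
      (dvd_of_dvd_sub_of_dvd hf (dvd_sub_comm.1 hz2) hy)

theorem int_pow_dvd_iff_le_padicValInt {p : ℕ} (hp : p.Prime) {z : ℤ} (hz : z ≠ 0) {j : ℕ} :
    (p : ℤ) ^ j ∣ z ↔ j ≤ padicValInt p z := by
  have := Fact.mk hp
  rw [padicValInt_dvd_iff]
  simp [hz]

theorem exists_eq_pow_padicValInt_mul {p : ℕ} (hp : p.Prime) {z : ℤ} (hz : z ≠ 0) :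
    ∃ w, z = (p : ℤ) ^ padicValInt p z * w ∧ ¬ (p : ℤ) ∣ w := by
  obtain ⟨w, h⟩ := (int_pow_dvd_iff_le_padicValInt hp hz).2 le_rfl
  refine ⟨w, h, ?_⟩
  rintro ⟨v, rfl⟩
  have h2 : (p : ℤ) ^ (padicValInt p z + 1) ∣ z :=
    ⟨v, by rw [pow_succ, mul_assoc]; exact h⟩
  have := (int_pow_dvd_iff_le_padicValInt hp hz).1 h2
  omega

/-- An obstruction rules out square roots `y` of `d` modulo `p ^ α` with `y ≡ b mod p ^ β`. -/
theorem not_obstruction_of_sq {p α β : ℕ} (hp : p.Prime) (hβ : β ≤ α) {b d y : ℤ}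
    (hy : (p : ℤ) ^ α ∣ y ^ 2 - d) (hyb : (p : ℤ) ^ β ∣ y - b) : ¬ Obstruction p α β b d := by
  have hpZ : Prime (p : ℤ) := Nat.prime_iff_prime_int.1 hp
  have hp0 : (p : ℤ) ≠ 0 := hpZ.ne_zero
  have hpos : (0 : ℤ) < p := by exact_mod_cast hp.pos
  -- every integer `w` is congruent modulo `p ^ e` to a natural number below `p ^ e`
  have hred : ∀ (w : ℤ) (e : ℕ), ∃ i : ℕ, i < p ^ e ∧ (p : ℤ) ^ e ∣ w - i := by
    intro w e
    have h1 := Int.emod_nonneg w (pow_ne_zero e hp0)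
    have h2 := Int.emod_lt_of_pos w (pow_pos hpos e)
    refine ⟨(w % (p : ℤ) ^ e).toNat, ?_, ?_⟩
    · zify
      rwa [Int.toNat_of_nonneg h1]
    · rw [Int.toNat_of_nonneg h1]
      exact Int.dvd_self_sub_emod
  rintro (⟨hd, μ, d₁, rfl, hd₁, hobs⟩ | ⟨hd, s, hs, hobs⟩)
  · have hμ : 2 * μ < α := by
      by_contra hc
      exact hd ((pow_dvd_pow _ (by omega)).mul_left _)
    have hy2 : (p : ℤ) ^ (2 * μ) ∣ y ^ 2 :=
      (dvd_sub_left (dvd_mul_left _ _)).1 ((pow_dvd_pow _ hμ.le).trans hy)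
    obtain ⟨z, rfl⟩ := pow_dvd_of_pow_dvd_sq hpZ (t := μ) (by omega) hy2
    obtain ⟨e, rfl⟩ : ∃ e, α = 2 * μ + e := ⟨α - 2 * μ, by omega⟩
    have hz : (p : ℤ) ^ e ∣ z ^ 2 - d₁ := by
      rw [show ((p : ℤ) ^ μ * z) ^ 2 - d₁ * (p : ℤ) ^ (2 * μ) = (p : ℤ) ^ (2 * μ) * (z ^ 2 - d₁) by
        ring, pow_add] at hy
      exact (mul_dvd_mul_iff_left (pow_ne_zero _ hp0)).1 hy
    obtain ⟨σ, hσ, w, hw⟩ := hred z e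
    obtain ⟨i, hi, v, hv⟩ := hred w μ
    refine hobs σ ?_ i hi ?_
    · rw [Nat.add_sub_cancel_left]
      refine ⟨by positivity, by exact_mod_cast hσ, ?_⟩
      refine (Int.modEq_iff_dvd.2 ?_).symm
      push_cast
      exact dvd_of_dvd_sub_of_dvd (sub_dvd_sq_sub d₁) ⟨w, hw⟩ hz
    · refine (Int.modEq_iff_dvd.2 ?_).symm
      have e1 : 2 * μ + e - μ = e + μ := by omega
      rw [e1]
      have h1 : (p : ℤ) ^ β ∣ (p : ℤ) ^ (2 * μ + e) * v := (pow_dvd_pow _ hβ).mul_right _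
      have h2 := dvd_sub hyb h1
      have h3 : (σ : ℤ) * (p : ℤ) ^ μ + i * (p : ℤ) ^ (e + μ) - b =
          ((p : ℤ) ^ μ * z - b) - (p : ℤ) ^ (2 * μ + e) * v := by
        linear_combination -(p : ℤ) ^ μ * hw - (p : ℤ) ^ (e + μ) * hv
      rw [h3]
      exact h2
  · have hy2 : (p : ℤ) ^ α ∣ y ^ 2 := (dvd_sub_left hd).1 hy
    obtain ⟨w, rfl⟩ := pow_dvd_of_pow_dvd_sq hpZ (t := s) (by omega) hy2
    obtain ⟨i, hi, v, hv⟩ := hred w (α - s)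
    refine hobs i hi (Int.modEq_iff_dvd.2 ?_).symm
    rcases Nat.eq_zero_or_pos α with rfl | hα
    · obtain rfl : β = 0 := by omega
      simp
    have h1 : (p : ℤ) ^ β ∣ (p : ℤ) ^ (s + (α - s)) * v := (pow_dvd_pow _ (by omega)).mul_right _
    have h2 := dvd_sub hyb h1
    have h3 : (i : ℤ) * (p : ℤ) ^ s - b =
          ((p : ℤ) ^ s * w - b) - (p : ℤ) ^ (s + (α - s)) * v := by
      rw [pow_add]
      linear_combination -(p : ℤ) ^ s * hv
    rw [h3]
    exact h2

/-- If `d` is a square modulo `p ^ α`, then the absence of an obstruction provides a square root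
`y ≡ b mod p ^ β`. -/
theorem exists_sq_of_not_obstruction {p α β : ℕ} (hp : p.Prime) {b d : ℤ}
    (h : ¬ Obstruction p α β b d) (hd : ∃ y : ℤ, (p : ℤ) ^ α ∣ y ^ 2 - d) :
    ∃ y : ℤ, (p : ℤ) ^ α ∣ y ^ 2 - d ∧ (p : ℤ) ^ β ∣ y - b := by
  have hpZ : Prime (p : ℤ) := Nat.prime_iff_prime_int.1 hp
  have hp0 : (p : ℤ) ≠ 0 := hpZ.ne_zero
  rw [Obstruction, not_or] at h
  by_cases hdvd : (p : ℤ) ^ α ∣ d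
  · have h2 := h.2
    simp only [ObstructionDvd, hdvd, true_and, not_exists, not_and, not_forall, not_not] at h2
    obtain ⟨s, hs⟩ : ∃ s, α = 2 * s ∨ α + 1 = 2 * s := ⟨(α + 1) / 2, by omega⟩
    obtain ⟨i, hi, hib⟩ := h2 s hs
    refine ⟨i * (p : ℤ) ^ s, dvd_sub ?_ hdvd, Int.modEq_iff_dvd.1 hib.symm⟩
    rw [mul_pow, ← pow_mul]
    exact (pow_dvd_pow _ (by omega)).mul_left _
  · obtain ⟨y, hy⟩ := hd
    have hd0 : d ≠ 0 := by rintro rfl; simp at hdvd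
    have hy2 : ¬ (p : ℤ) ^ α ∣ y ^ 2 := fun h => hdvd ((dvd_sub_right h).1 hy)
    have hy0 : y ≠ 0 := by
      rintro rfl
      rcases Nat.eq_zero_or_pos α with rfl | hα
      · simp at hdvd
      · exact hy2 (by simp)
    obtain ⟨μ, z, hz, rfl⟩ := WfDvdMonoid.max_power_factor hy0 hpZ.irreducible
    have hμ : 2 * μ < α := by
      by_contra hc
      apply hy2
      rw [mul_pow, ← pow_mul]
      exact (pow_dvd_pow _ (by omega)).mul_right _
    obtain ⟨e, rfl⟩ : ∃ e, α = 2 * μ + (e + 1) := ⟨α - 2 * μ - 1, by omega⟩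
    obtain ⟨q, hq⟩ := hy
    have hd₁ : d = (z ^ 2 - p ^ (e + 1) * q) * (p : ℤ) ^ (2 * μ) := by
      linear_combination -hq
    have hpd₁ : ¬ (p : ℤ) ∣ z ^ 2 - p ^ (e + 1) * q := fun h =>
      hz (hpZ.dvd_of_dvd_pow ((dvd_sub_left
        ((dvd_pow_self _ (Nat.succ_ne_zero e)).mul_right _)).1 h))
    have h1 := h.1
    simp only [ObstructionNotDvd, hdvd, not_false_eq_true, true_and, not_exists, not_and,
      not_forall, not_not] at h1
    obtain ⟨σ, hσ, i, hi, hib⟩ := h1 μ _ hd₁ hpd₁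
    refine ⟨_, ?_, Int.modEq_iff_dvd.1 hib.symm⟩
    obtain ⟨-, -, hσ⟩ := hσ
    obtain ⟨t, ht⟩ := Int.modEq_iff_dvd.1 hσ.symm
    have e1 : 2 * μ + (e + 1) - 2 * μ = e + 1 := by omega
    have e2 : 2 * μ + (e + 1) - μ = μ + (e + 1) := by omega
    rw [e1] at ht
    rw [e2]
    push_cast at ht
    refine ⟨t + 2 * σ * i + i ^ 2 * (p : ℤ) ^ (e + 1), ?_⟩
    rw [hd₁]
    linear_combination (p : ℤ) ^ (2 * μ) * ht

/-- A square root of the discriminant `d` modulo `p ^ α`, where `α` is the multiplicity of `p` in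
`4 * a * M`, that is `≡ b` modulo the `p`-part of `2 * a`, yields a root modulo the `p`-part of
`M`. -/
theorem exists_pow_dvd_quadratic_of_sq {p : ℕ} (hp : p.Prime) {a b c M y : ℤ} (ha : a ≠ 0)
    (hM : M ≠ 0)
    (hy : (p : ℤ) ^ padicValInt p (4 * a * M) ∣ y ^ 2 - (b ^ 2 - 4 * a * c))
    (hyb : (p : ℤ) ^ padicValInt p (2 * a) ∣ y - b) {j : ℕ} (hj : (p : ℤ) ^ j ∣ M) :
    ∃ x, (p : ℤ) ^ j ∣ a * x ^ 2 + b * x + c := by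
  have hpZ : Prime (p : ℤ) := Nat.prime_iff_prime_int.1 hp
  obtain ⟨w, hw, hpw⟩ := exists_eq_pow_padicValInt_mul hp (mul_ne_zero two_ne_zero ha)
  obtain ⟨z, hz⟩ := hyb
  set α := padicValInt p (4 * a * M) with hα
  set β := padicValInt p (2 * a)
  have hcop : IsCoprime w ((p : ℤ) ^ α) := ((Prime.coprime_iff_not_dvd hpZ).2 hpw).symm.pow_right
  obtain ⟨x, hx⟩ := exists_dvd_mul_add_sub hcop 0 z
  refine ⟨x, ?_⟩
  have h1 : (p : ℤ) ^ α ∣ (2 * a * x + b) - y := by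
    rw [show (2 * a * x + b) - y = (p : ℤ) ^ β * (w * x + 0 - z) by
      linear_combination x * hw - hz]
    exact hx.mul_left _
  have h2 := dvd_of_dvd_sub_of_dvd (sub_dvd_sq_sub (b ^ 2 - 4 * a * c)) (dvd_sub_comm.1 h1) hy
  rw [show (2 * a * x + b) ^ 2 - (b ^ 2 - 4 * a * c) = 4 * a * (a * x ^ 2 + b * x + c) by ring]
    at h2
  obtain ⟨v, hv, hpv⟩ := exists_eq_pow_padicValInt_mul hp
    (mul_ne_zero four_ne_zero ha : (4 : ℤ) * a ≠ 0)
  have h3 : (p : ℤ) ^ (padicValInt p (4 * a) + j) ∣ 4 * a * M := by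
    rw [pow_add]
    exact mul_dvd_mul ((int_pow_dvd_iff_le_padicValInt hp (by simp [ha])).2 le_rfl) hj
  have h4 := (pow_dvd_pow (p : ℤ)
    ((int_pow_dvd_iff_le_padicValInt hp (by simp [ha, hM])).1 h3)).trans h2
  rw [hv, pow_add, mul_assoc] at h4
  rw [← hv] at h4
  exact hpZ.pow_dvd_of_dvd_mul_left _ hpv
    ((mul_dvd_mul_iff_left (pow_ne_zero _ hpZ.ne_zero)).1 h4)

theorem ite_padicValInt_eq (p k m : ℕ) (a : ℤ) :
    (if k ≤ 2 then padicValInt p (4 * a * (m : ℤ)) else padicValInt p (2 ^ k * a * (m : ℤ))) =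
      padicValInt p (4 * a * (2 ^ (k - 2) * m)) := by
  split_ifs with hk
  · rw [Nat.sub_eq_zero_of_le hk, pow_zero, one_mul]
  · obtain ⟨j, rfl⟩ : ∃ j, k = j + 2 := ⟨k - 2, by omega⟩
    rw [Nat.add_sub_cancel]
    congr 1
    ring

/-- `CondI` excludes roots modulo `2 ^ (k - 2) * m`. -/
theorem CondI.not_dvd {a b c : ℤ} {k m : ℕ} (hm : m ≠ 0) (ha : a ≠ 0)
    (h : CondI a b (b ^ 2 - 4 * a * c) k m) (x : ℤ) :
    ¬ (2 ^ (k - 2) * m : ℤ) ∣ a * x ^ 2 + b * x + c := by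
  intro hx
  obtain ⟨p, hp, -, α, β, hβ, hα, -, hβα, -, -, hobs⟩ := h
  rw [ite_padicValInt_eq] at hα
  refine not_obstruction_of_sq hp hβα.le (y := 2 * a * x + b) ?_ ?_ hobs
  · rw [show (2 * a * x + b) ^ 2 - (b ^ 2 - 4 * a * c) = 4 * a * (a * x ^ 2 + b * x + c) by ring]
    refine Dvd.dvd.trans ?_ (mul_dvd_mul_left (4 * a) hx)
    exact (int_pow_dvd_iff_le_padicValInt hp (by simp [ha, hm])).2 hα.le
  · rw [add_sub_cancel_right]
    exact ((int_pow_dvd_iff_le_padicValInt hp (by simp [ha])).2 hβ.le).mul_right _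

/-- If `d` is a square modulo `n = r * 2 ^ k * m` and `CondI` fails, then there are roots modulo
`2 ^ (k - 2) * m`. -/
theorem exists_dvd_of_not_condI {a' b c : ℤ} {r k m : ℕ} (hr : r ≠ 0) (hm : Odd m) (ha : a' ≠ 0)
    (hcop : IsCoprime a' (2 ^ k * m)) (hQ : IsQuadRes (r * (2 ^ k * m)) (b ^ 2 - 4 * (r * a') * c))
    (h : ¬ CondI (r * a') b (b ^ 2 - 4 * (r * a') * c) k m) :
    ∃ x : ℤ, (2 ^ (k - 2) * m : ℤ) ∣ r * a' * x ^ 2 + b * x + c := by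
  have hm0 : m ≠ 0 := hm.pos.ne'
  have ha0 : (r : ℤ) * a' ≠ 0 := mul_ne_zero (by exact_mod_cast hr) ha
  have hM0 : (2 ^ (k - 2) * m : ℤ) ≠ 0 := by simp [hm0]
  suffices ∃ x : ℤ, ((2 ^ (k - 2) * m : ℕ) : ℤ) ∣ r * a' * x ^ 2 + b * x + c by simpa using this
  refine exists_dvd_of_forall_prime_pow (sub_dvd_quadratic_sub _ b c) _ (by simp [hm0])
    fun p j hp hj => ?_
  have hpZ : Prime (p : ℤ) := Nat.prime_iff_prime_int.1 hp
  rcases Nat.eq_zero_or_pos j with rfl | hj0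
  · exact ⟨0, by simp⟩
  have hjM : (p : ℤ) ^ j ∣ 2 ^ (k - 2) * m := by exact_mod_cast hj
  have hMk : (2 ^ (k - 2) * m : ℕ) ∣ 2 ^ k * m := mul_dvd_mul_right (pow_dvd_pow _ (by omega)) _
  have hpMk : p ∣ 2 ^ k * m := ((dvd_pow_self p hj0.ne').trans hj).trans hMk
  have hpMkZ : (p : ℤ) ∣ 2 ^ k * m := by exact_mod_cast hpMk
  have hpa' : ¬ (p : ℤ) ∣ a' := fun h =>
    hpZ.not_isUnit (hcop.isUnit_of_dvd' h hpMkZ)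
  obtain ⟨y, hy⟩ := hQ
  have hy' := Int.modEq_iff_dvd.1 hy.symm
  by_cases h2a : (p : ℤ) ∣ 2 * (r * a')
  swap
  · -- `2 * a` is invertible modulo `p`
    refine exists_pow_dvd_quadratic_of_sq hp ha0 hM0 (y := y) ?_ ?_ hjM
    · have h4 : ¬ (p : ℤ) ∣ 4 * (r * a') := fun h => h2a (by
        rw [show (4 : ℤ) * (r * a') = 2 * (2 * (r * a')) by ring] at h
        rcases hpZ.dvd_or_dvd h with h | h
        · exact h.mul_right _
        · exact h)
      refine Dvd.dvd.trans ?_ ((Int.natCast_dvd_natCast.2 (hMk.mul_left r)).trans hy')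
      have := (int_pow_dvd_iff_le_padicValInt hp (mul_ne_zero (by simpa using ha0) hM0)).2
        (le_refl (padicValInt p (4 * (r * a') * (2 ^ (k - 2) * m))))
      push_cast
      exact hpZ.pow_dvd_of_dvd_mul_left _ h4 this
    · rw [padicValInt.eq_zero_of_not_dvd h2a]
      simp
  by_cases hpb : (p : ℤ) ∣ r * a' ∧ ¬ (p : ℤ) ∣ b
  · exact exists_pow_dvd_quadratic hpZ hpb.1 hpb.2 c j
  set α := padicValInt p (4 * (r * a') * (2 ^ (k - 2) * m)) with hα
  set β := padicValInt p (2 * (r * a')) with hβ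
  suffices ∃ y : ℤ, (p : ℤ) ^ α ∣ y ^ 2 - (b ^ 2 - 4 * (r * a') * c) ∧ (p : ℤ) ^ β ∣ y - b by
    obtain ⟨y, h1, h2⟩ := this
    exact exists_pow_dvd_quadratic_of_sq hp ha0 hM0 h1 h2 hjM
  -- `d` is a square modulo `p ^ α`, since `p ^ α` divides `n`
  have hαn : (p : ℤ) ^ α ∣ ((r * (2 ^ k * m) : ℕ) : ℤ) := by
    have h1 : (p : ℤ) ^ α ∣ 4 * (r * a') * (2 ^ (k - 2) * m) :=
      (int_pow_dvd_iff_le_padicValInt hp (by simpa [hm0] using ha0)).2 le_rfl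
    have h2 : (p : ℤ) ^ α ∣ r * (4 * (2 ^ (k - 2) * m)) := by
      refine hpZ.pow_dvd_of_dvd_mul_left _ hpa' ?_
      rw [show a' * (r * (4 * (2 ^ (k - 2) * m))) = 4 * (r * a') * (2 ^ (k - 2) * (m : ℤ)) by ring]
      exact h1
    by_cases hp2 : p = 2
    · subst hp2
      obtain ⟨i, rfl⟩ : ∃ i, k = i + 2 := by
        refine ⟨k - 2, ?_⟩
        by_contra hk
        have : k - 2 = 0 := by omega
        rw [this, pow_zero, one_mul] at hj
        have := (dvd_pow_self 2 hj0.ne').trans hj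
        rw [Nat.odd_iff] at hm
        omega
      rw [Nat.add_sub_cancel] at h2
      push_cast
      rwa [show (r : ℤ) * (2 ^ (i + 2) * m) = r * (4 * (2 ^ i * m)) by ring]
    · have h4 : ¬ (p : ℤ) ∣ 4 := fun h => hp2 (by
        have h5 := hpZ.dvd_of_dvd_pow (show (p : ℤ) ∣ 2 ^ 2 by norm_num; exact h)
        exact (Nat.prime_dvd_prime_iff_eq hp Nat.prime_two).1 (by exact_mod_cast h5))
      refine (hpZ.pow_dvd_of_dvd_mul_left (a := 4) _ h4 ?_).trans
        (Int.natCast_dvd_natCast.2 (mul_dvd_mul_left r hMk))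
      push_cast
      rwa [mul_left_comm]
  have hyα := hαn.trans hy'
  have hβα : β < α := by
    have h1 : (p : ℤ) ^ (β + 1) ∣ 4 * (r * a') * (2 ^ (k - 2) * m) := by
      rw [show (4 : ℤ) * (r * a') * (2 ^ (k - 2) * m) =
        2 * (r * a') * (2 * (2 ^ (k - 2) * m)) by ring, pow_succ]
      exact mul_dvd_mul ((int_pow_dvd_iff_le_padicValInt hp (by simpa using ha0)).2 le_rfl)
        (((dvd_pow_self _ hj0.ne').trans hjM).mul_left 2)
    exact (int_pow_dvd_iff_le_padicValInt hp (by simpa [hm0] using ha0)).1 h1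
  rcases Nat.lt_or_ge 1 β with h1β | h1β
  · -- here `p` divides `a`, hence `b`, and `p ^ 2` divides `d`
    have hp4 : (p : ℤ) ^ 2 ∣ 2 * (r * a') := (int_pow_dvd_iff_le_padicValInt hp
      (by simpa using ha0)).2 h1β
    have hpa : (p : ℤ) ∣ r * a' := by
      by_cases hp2 : p = 2
      · subst hp2
        rw [sq] at hp4
        exact (mul_dvd_mul_iff_left two_ne_zero).1 hp4
      · rcases hpZ.dvd_or_dvd h2a with h | h
        · exact absurd ((Nat.prime_dvd_prime_iff_eq hp Nat.prime_two).1 (by exact_mod_cast h)) hp2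
        · exact h
    have hpb' : (p : ℤ) ∣ b := by
      by_contra hb
      exact hpb ⟨hpa, hb⟩
    refine exists_sq_of_not_obstruction hp (fun hobs => h ?_) ⟨y, hyα⟩
    refine ⟨p, hp, h2a, α, β, hβ, ?_, h1β, hβα, hpb', ?_, hobs⟩
    · rw [ite_padicValInt_eq]
    · refine dvd_sub (pow_dvd_pow_of_dvd hpb' 2) ?_
      rw [show (4 : ℤ) * (r * a') * c = 2 * (r * a') * (2 * c) by ring]
      exact hp4.mul_right _
  · -- modulo `p` the square roots of `b ^ 2` are `±b`
    have h1 : (p : ℤ) ∣ y ^ 2 - (b ^ 2 - 4 * (r * a') * c) :=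
      (dvd_pow_self _ (by omega)).trans hyα
    have h2 : (p : ℤ) ∣ (y - b) * (y + b) := by
      rw [show (y - b) * (y + b) = (y ^ 2 - (b ^ 2 - 4 * (r * a') * c)) -
        2 * (r * a') * (2 * c) by ring]
      exact dvd_sub h1 (h2a.mul_right _)
    have hβp : (p : ℤ) ^ β ∣ p := by
      simpa using pow_dvd_pow (p : ℤ) h1β
    rcases hpZ.dvd_or_dvd h2 with h3 | h3
    · exact ⟨y, hyα, hβp.trans h3⟩
    · refine ⟨-y, by rw [neg_sq]; exact hyα, hβp.trans ?_⟩
      rw [show -y - b = -(y + b) by ring]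
      exact (dvd_neg).2 h3

/-! ### The condition at the prime `2` for quadratics -/

/-- The condition at `2` for `k ≥ 3`. Shifting a root by `2 ^ (k - 2)` shows that `b = 2 * h` is
even, so that `a * f x = (a * x + h) ^ 2 - (h ^ 2 - a * c)` reduces the question to squares. -/
theorem lifts_two_pow_quadratic_iff {a b c : ℤ} {k : ℕ} {r : ℕ} (hk : 3 ≤ k) (ha : Odd a) :
    Lifts r (fun x => a * x ^ 2 + b * x + c) (2 ^ (k - 2)) (2 ^ k) ↔
      Odd r ∧ Odd k ∧ ∃ u : ℤ, u ≡ 1 [ZMOD 8] ∧ b ^ 2 - 4 * a * c = 2 ^ (k - 1) * u := by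
  obtain ⟨K, rfl⟩ : ∃ K, k = K + 3 := ⟨k - 3, by omega⟩
  have hk1 : K + 3 - 2 = K + 1 := by omega
  have hk2 : K + 3 - 1 = K + 2 := by omega
  rw [hk1, hk2]
  have hac : IsCoprime a (2 ^ (K + 3)) :=
    ((Prime.coprime_iff_not_dvd Int.prime_two).2 fun h =>
      Int.not_even_iff_odd.2 ha (even_iff_two_dvd.2 h)).symm.pow_right
  have hodd : Odd (K + 3) ↔ Even K := by grind
  have hdvd : (2 : ℤ) ^ (K + 1) ∣ 2 ^ (K + 3) := pow_dvd_pow _ (by omega)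
  by_cases hb : 2 ∣ b
  · obtain ⟨h, rfl⟩ := hb
    rw [lifts_iff_lifts_sq_sub (w := a) (A := a) (B := h) (E := h ^ 2 - a * c) (fun x => by ring)
      hac hac hdvd, hodd]
    by_cases hr : Odd r
    · have hrc : IsCoprime (r : ℤ) (2 ^ (K + 1)) :=
        ((Prime.coprime_iff_not_dvd Int.prime_two).2 fun h =>
          Nat.not_even_iff_odd.2 hr (even_iff_two_dvd.2 (by exact_mod_cast h))).symm.pow_right
      have h1 : ∀ z : ℤ, 2 ^ (K + 1) ∣ (r : ℤ) * z ↔ (2 : ℤ) ^ (K + 1) ∣ 1 * z := fun z => by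
        rw [one_mul]
        exact ⟨hrc.symm.dvd_of_dvd_mul_left, fun h => h.mul_left _⟩
      have h2 := lifts_two_pow_iff K (h ^ 2 - a * c)
      simp only [Lifts, h1] at h2 ⊢
      rw [h2]
      simp only [hr, true_and]
      refine and_congr_right fun _ => exists_congr fun u => and_congr_right fun _ => ?_
      constructor
      · intro h3
        linear_combination 4 * h3
      · intro h3
        have : 4 * (h ^ 2 - a * c) = 4 * (2 ^ K * u) := by linear_combination h3
        linarith
    · refine iff_of_false (fun hl => ?_) fun h => hr h.1
      have hr2 : (2 : ℤ) ∣ r := by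
        exact_mod_cast (Nat.not_odd_iff_even.1 hr).two_dvd
      have h1 : ∀ z : ℤ, 2 ^ K ∣ z → (2 : ℤ) ^ (K + 1) ∣ r * z := fun z hz => by
        rw [pow_succ, mul_comm]
        exact mul_dvd_mul hr2 hz
      refine not_lifts_two_pow_add_three K (h ^ 2 - a * c) ⟨?_, fun y hy => ?_⟩
      · obtain ⟨y, hy⟩ := hl.1
        have := hl.2 y hy
        exact ⟨y, by rw [one_mul]; exact (pow_dvd_pow _ (by omega)).trans this⟩
      · rw [one_mul] at hy
        exact hl.2 y (h1 _ hy)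
  · refine iff_of_false (fun hl => hb ?_) ?_
    · obtain ⟨⟨x, hx⟩, hl⟩ := hl
      have hx' := hl x hx
      have h1 := hl (x + 2 ^ (K + 1)) (dvd_mul_of_dvd_sub_of_dvd (sub_dvd_quadratic_sub a b c)
        (by simp) hx)
      have h2 : (2 : ℤ) ^ (K + 1) * 2 ∣ 2 ^ (K + 1) * (2 * (a * x + a * 2 ^ K) + b) := by
        rw [show (2 : ℤ) ^ (K + 1) * (2 * (a * x + a * 2 ^ K) + b) =
          (a * (x + 2 ^ (K + 1)) ^ 2 + b * (x + 2 ^ (K + 1)) + c) - (a * x ^ 2 + b * x + c) by ring,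
          ← pow_succ]
        exact (pow_dvd_pow _ (by omega)).trans (dvd_sub h1 hx')
      have h3 := (mul_dvd_mul_iff_left (by positivity)).1 h2
      omega
    · rintro ⟨-, -, u, -, hu⟩
      have h1 : 2 ∣ b ^ 2 := ⟨2 * a * c + 2 ^ (K + 1) * u, by linear_combination hu⟩
      exact hb (Int.prime_two.dvd_of_dvd_pow h1)

theorem lifts_one_two_iff {a b c r : ℤ} (ha : Odd a) :
    Lifts r (fun x => a * x ^ 2 + b * x + c) 1 2 ↔ Odd b ∧ Even c := by
  constructor
  · rintro ⟨-, hl⟩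
    have h0 := hl 0 (one_dvd _)
    have h1 := hl 1 (one_dvd _)
    norm_num at h0 h1
    grind
  · rintro ⟨hb, hc⟩
    refine ⟨⟨0, one_dvd _⟩, fun x _ => even_iff_two_dvd.1 ?_⟩
    rcases Int.even_or_odd x with hx | hx
    · exact ((hx.pow_of_ne_zero two_ne_zero).mul_left a |>.add (hx.mul_left b)).add hc
    · exact ((ha.mul hx.pow).add_odd (hb.mul hx)).add hc

theorem not_lifts_one_four {a b c r : ℤ} (ha : Odd a) :
    ¬ Lifts r (fun x => a * x ^ 2 + b * x + c) 1 4 := by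
  rintro ⟨-, hl⟩
  have h0 := hl 0 (one_dvd _)
  have h1 := hl 1 (one_dvd _)
  have h2 := hl (-1) (one_dvd _)
  norm_num at h0 h1 h2
  obtain ⟨t, rfl⟩ := ha
  omega

/-- The requirement that all roots of
`r * (a * x ^ 2 + b * x + c)` modulo `2 ^ (k - 2) * m` be roots of `a * x ^ 2 + b * x + c` modulo
`2 ^ k * m` splits into a condition at `2` and a condition at `m`. -/
theorem lifts_quadratic_iff {a b c : ℤ} {r k m δ : ℕ} (hm : Odd m)
    (hcop : IsCoprime a (2 ^ k * m)) (hδ : δ = Nat.gcd m r) :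
    Lifts r (fun x => a * x ^ 2 + b * x + c) (2 ^ (k - 2) * m) (2 ^ k * m) ↔
      Lifts r (fun x => a * x ^ 2 + b * x + c) (2 ^ (k - 2)) (2 ^ k) ∧
        DeltaCond (b ^ 2 - 4 * a * c) m δ := by
  have h2m : IsCoprime (2 : ℤ) m := by
    have := Nat.isCoprime_iff_coprime.2 (Nat.coprime_two_left.2 hm)
    simpa using this
  have ham : IsCoprime a (m : ℤ) := hcop.of_mul_right_right
  rw [lifts_mul_iff (sub_dvd_quadratic_sub a b c) (pow_dvd_pow _ (by omega)) dvd_rfl h2m.pow_left,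
    deltaCond_iff_lifts hm.pos.ne' hm hδ,
    lifts_iff_lifts_sq_sub (M := (m : ℤ)) (w := 2 * 2 * a) (A := 2 * a) (B := b)
      (E := b ^ 2 - 4 * a * c) (fun x => by ring) ((h2m.mul_left h2m).mul_left ham)
      (h2m.mul_left ham) dvd_rfl]

theorem eq_pow_mul_iff_padicValInt {D : ℤ} {k : ℕ} (hk : 3 ≤ k) :
    (∃ u : ℤ, u ≡ 1 [ZMOD 8] ∧ D = 2 ^ (k - 1) * u) ↔
      k - 1 = padicValInt 2 D ∧ D / 2 ^ (k - 1) ≡ 1 [ZMOD 8] := by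
  have hpos : (2 : ℤ) ^ (k - 1) ≠ 0 := by positivity
  constructor
  · rintro ⟨u, hu, rfl⟩
    rw [Int.mul_ediv_cancel_left _ hpos]
    refine ⟨?_, hu⟩
    have hu' := Int.modEq_iff_dvd.1 hu
    have hu0 : u ≠ 0 := by omega
    apply le_antisymm
    · exact (int_pow_dvd_iff_le_padicValInt Nat.prime_two (mul_ne_zero hpos hu0)).1
        (by exact_mod_cast dvd_mul_right _ _)
    · by_contra hc
      have h1 : ((2 : ℕ) : ℤ) ^ (k - 1 + 1) ∣ 2 ^ (k - 1) * u :=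
        (int_pow_dvd_iff_le_padicValInt Nat.prime_two (mul_ne_zero hpos hu0)).2 (by omega)
      rw [pow_succ] at h1
      have h2 : (2 : ℤ) ^ (k - 1) * 2 ∣ 2 ^ (k - 1) * u := by exact_mod_cast h1
      have h3 := (mul_dvd_mul_iff_left hpos).1 h2
      omega
  · rintro ⟨h1, h2⟩
    have hD : D ≠ 0 := by
      rintro rfl
      simp at h1
      omega
    have h3 := (int_pow_dvd_iff_le_padicValInt Nat.prime_two hD).2 h1.le
    exact ⟨_, h2, (Int.mul_ediv_cancel' (by exact_mod_cast h3)).symm⟩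

/-! ### The conditions on `r`, `k`, `m` and `δ` -/

/-- The conditions `CondII`, `CondIII` and `CondIV` together say that there are roots modulo
`2 ^ (k - 2) * m`, and that all of them are roots modulo `n = r * (2 ^ k * m)`. -/
theorem cond_iff {a' b c : ℤ} {r k m δ : ℕ} (hr : r ≠ 0) (hm : Odd m)
    (hcop : IsCoprime a' (2 ^ k * m)) (hδ : δ = Nat.gcd m r) :
    (CondII b c (b ^ 2 - 4 * (r * a') * c) r k m δ ∨
      CondIII (r * a') b c (b ^ 2 - 4 * (r * a') * c) r k m δ ∨
      CondIV b c (b ^ 2 - 4 * (r * a') * c) r k m δ) ↔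
    Lifts 1 (fun x => r * a' * x ^ 2 + b * x + c) (2 ^ (k - 2) * m) (r * (2 ^ k * m)) := by
  have hr0 : (r : ℤ) ≠ 0 := by exact_mod_cast hr
  by_cases hbc : (r : ℤ) ∣ b ∧ (r : ℤ) ∣ c
  swap
  · refine iff_of_false ?_ fun hl => hbc ?_
    · rintro (⟨-, h1, h2, -⟩ | ⟨-, h1, h2, -⟩ | ⟨-, -, -, h1, h2, -⟩) <;> exact hbc ⟨h1, h2⟩
    · obtain ⟨⟨x, hx⟩, hl⟩ := hl
      -- comparing the roots `x` and `x + M` of `f` modulo `n` forces `r` to divide `b`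
      have hx1 := hl x hx
      have hx2 := hl (x + 2 ^ (k - 2) * m)
        (dvd_mul_of_dvd_sub_of_dvd (sub_dvd_quadratic_sub _ b c) (by simp) hx)
      have hM0 : (2 ^ (k - 2) * m : ℤ) ≠ 0 := by
        have : (m : ℤ) ≠ 0 := by exact_mod_cast hm.pos.ne'
        positivity
      have hMd : (2 ^ (k - 2) * m : ℤ) ∣ 2 ^ k * m :=
        mul_dvd_mul_right (pow_dvd_pow _ (by omega)) _
      have h1 : (2 ^ (k - 2) * m : ℤ) * r ∣ (2 ^ (k - 2) * m : ℤ) *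
          (r * (2 * a' * x + a' * (2 ^ (k - 2) * m)) + b) := by
        rw [show (2 ^ (k - 2) * m : ℤ) * (r * (2 * a' * x + a' * (2 ^ (k - 2) * m)) + b) =
          (r * a' * (x + 2 ^ (k - 2) * m) ^ 2 + b * (x + 2 ^ (k - 2) * m) + c) -
            (r * a' * x ^ 2 + b * x + c) by ring, mul_comm]
        exact (mul_dvd_mul_left _ hMd).trans (dvd_sub hx2 hx1)
      have hb : (r : ℤ) ∣ b :=
        (dvd_add_right (dvd_mul_right _ _)).1 ((mul_dvd_mul_iff_left hM0).1 h1)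
      refine ⟨hb, ?_⟩
      have h2 : (r : ℤ) ∣ r * a' * x ^ 2 + b * x + c := (dvd_mul_right _ _).trans hx1
      exact (dvd_add_right (((dvd_mul_right _ _).mul_right _).add (hb.mul_right x))).1 h2
  obtain ⟨⟨b, rfl⟩, ⟨c, rfl⟩⟩ := hbc
  have hl : Lifts 1 (fun x => r * a' * x ^ 2 + r * b * x + r * c) (2 ^ (k - 2) * m)
      (r * (2 ^ k * m)) ↔
      Lifts r (fun x => a' * x ^ 2 + b * x + c) (2 ^ (k - 2) * m) (2 ^ k * m) := by
    have h1 : ∀ x : ℤ, r * a' * x ^ 2 + r * b * x + r * c = r * (a' * x ^ 2 + b * x + c) :=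
      fun x => by ring
    simp only [Lifts, h1, one_mul, mul_dvd_mul_iff_left hr0]
  rw [hl, lifts_quadratic_iff hm hcop hδ]
  set D := b ^ 2 - 4 * a' * c with hD
  have hd : (r * b) ^ 2 - 4 * (r * a') * (r * c) = (r : ℤ) ^ 2 * D := by rw [hD]; ring
  have hd2 : (r : ℤ) ^ 2 * D / (r : ℤ) ^ 2 = D := Int.mul_ediv_cancel_left _ (by positivity)
  have hd3 : (r : ℤ) ^ 2 * D / ((r : ℤ) ^ 2 * 2 ^ (k - 1)) = D / 2 ^ (k - 1) :=
    Int.mul_ediv_mul_of_pos _ _ (by positivity)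
  have hae : 1 ≤ k → Odd a' := fun hk => by
    rw [← Int.not_even_iff_odd]
    intro h
    exact Int.prime_two.not_isUnit (hcop.isUnit_of_dvd' h.two_dvd
      ((dvd_pow_self 2 (by omega)).mul_right _))
  simp only [CondII, CondIII, CondIV, hd, hd2, hd3, dvd_mul_right, true_and,
    Int.mul_ediv_cancel_left _ hr0]
  rcases (by omega : k = 0 ∨ k = 1 ∨ k = 2 ∨ 3 ≤ k) with rfl | rfl | rfl | hk
  · have : Lifts r (fun x => a' * x ^ 2 + b * x + c) (2 ^ (0 - 2)) (2 ^ 0) :=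
      ⟨⟨0, by simp⟩, fun x _ => by simp⟩
    simp only [this, true_and, zero_ne_one, false_and, or_false,
      show ¬ 3 ≤ 0 by decide]
  · have ha := hae le_rfl
    have h1 := lifts_one_two_iff (b := b) (c := c) (r := r) ha
    have h2 : ¬ Even a' := Int.not_even_iff_odd.2 ha
    norm_num [h1, h2, and_assoc]
  · have h1 := not_lifts_one_four (b := b) (c := c) (r := r) (hae (by omega))
    norm_num [h1]
  · rw [lifts_two_pow_quadratic_iff hk (hae (by omega)), ← hD, eq_pow_mul_iff_padicValInt hk]
    have h0 : k ≠ 0 := by omega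
    have h1 : k ≠ 1 := by omega
    simp only [h0, h1, hk, true_and, false_and, false_or, and_assoc]

/-! ### Validity -/

/-- Validity means that the factor `4 * a` in `4 * a * f x = (2 * a * x + b) ^ 2 - d` may be
cancelled modulo `n`. -/
theorem valid_iff (a b c : ℤ) (n : ℕ) : Valid a b c n ↔
    ∀ x, (n : ℤ) ∣ 4 * a * (a * x ^ 2 + b * x + c) → (n : ℤ) ∣ a * x ^ 2 + b * x + c := by
  have key : ∀ x : ℤ, (∃ s : ℤ, s ^ 2 ≡ b ^ 2 - 4 * a * c [ZMOD (n : ℤ)] ∧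
      2 * a * x ≡ -b + s [ZMOD (n : ℤ)]) ↔ (n : ℤ) ∣ 4 * a * (a * x ^ 2 + b * x + c) := by
    intro x
    have e : 4 * a * (a * x ^ 2 + b * x + c) = (2 * a * x + b) ^ 2 - (b ^ 2 - 4 * a * c) := by ring
    rw [e]
    constructor
    · rintro ⟨s, hs, hx⟩
      refine dvd_of_dvd_sub_of_dvd (sub_dvd_sq_sub _) ?_ (Int.modEq_iff_dvd.1 hs.symm)
      convert Int.modEq_iff_dvd.1 hx using 1
      ring
    · intro h
      exact ⟨2 * a * x + b, (Int.modEq_iff_dvd.2 h).symm, by rw [neg_add_cancel_comm_assoc]⟩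
  simp only [Valid, key, Int.modEq_zero_iff_dvd]
  exact forall_congr' fun x => ⟨fun h => h.2, fun h => ⟨fun hx => hx.mul_left _, h⟩⟩

/-- Since `a'` is coprime to `2 ^ k * m`, cancelling `4 * (r * a')` from a divisibility by
`r * (2 ^ k * m)` leaves the modulus `2 ^ (k - 2) * m`. The truncated subtraction makes the power
of `2` trivial for `k ≤ 2`. -/
theorem mul_dvd_four_mul_iff {a' : ℤ} {r k m : ℕ} (hr : r ≠ 0) (hm : Odd m)
    (hcop : IsCoprime a' (2 ^ k * m)) (z : ℤ) :
    (r * (2 ^ k * m) : ℤ) ∣ 4 * (r * a') * z ↔ (2 ^ (k - 2) * m : ℤ) ∣ z := by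
  have hr0 : (r : ℤ) ≠ 0 := by exact_mod_cast hr
  rw [show 4 * (r * a') * z = r * (a' * (4 * z)) by ring, mul_dvd_mul_iff_left hr0]
  have h1 : (2 ^ k * m : ℤ) ∣ a' * (4 * z) ↔ (2 ^ k * m : ℤ) ∣ 4 * z :=
    ⟨hcop.symm.dvd_of_dvd_mul_left, fun h => h.mul_left _⟩
  rw [h1]
  rcases Nat.lt_or_ge k 2 with hk | hk
  · rw [Nat.sub_eq_zero_of_le hk.le, pow_zero, one_mul]
    have h2m : IsCoprime (2 : ℤ) m := by
      have := Nat.isCoprime_iff_coprime.2 (Nat.coprime_two_left.2 hm)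
      simpa using this
    constructor
    · intro h
      rw [show (4 : ℤ) * z = 2 * (2 * z) by ring] at h
      exact h2m.symm.dvd_of_dvd_mul_left
        (h2m.symm.dvd_of_dvd_mul_left ((dvd_mul_left _ _).trans h))
    · intro h
      exact mul_dvd_mul ((pow_dvd_pow 2 hk.le).trans (by norm_num)) h
  · obtain ⟨j, rfl⟩ : ∃ j, k = j + 2 := ⟨k - 2, by omega⟩
    rw [Nat.add_sub_cancel, show (2 ^ (j + 2) * m : ℤ) = 4 * (2 ^ j * m) by ring]
    exact mul_dvd_mul_iff_left four_ne_zero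

theorem mutuallyExclusive_of {A B C D : Prop} (hA : A → ¬ (B ∨ C ∨ D)) (hBC : ¬ (B ∧ C))
    (hBD : ¬ (B ∧ D)) (hCD : ¬ (C ∧ D)) : MutuallyExclusive A B C D :=
  ⟨fun h => hA h.1 (.inl h.2), fun h => hA h.1 (.inr (.inl h.2)),
    fun h => hA h.1 (.inr (.inr h.2)), hBC, hBD, hCD⟩

theorem MutuallyExclusive.exactlyOne_iff {A B C D : Prop} (h : MutuallyExclusive A B C D) :
    ExactlyOne A B C D ↔ A ∨ B ∨ C ∨ D := by
  obtain ⟨h1, h2, h3, h4, h5, h6⟩ := h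
  by_cases hA : A <;> by_cases hB : B <;> by_cases hC : C <;> by_cases hD : D <;>
    simp_all [ExactlyOne]

/-- The characterization of validity in terms of the factorization `n = r * (2 ^ k * m)`, with
`a = r * a'` and `a'` coprime to `2 ^ k * m`. -/
theorem valid_iff_cond {a' b c : ℤ} {r k m δ : ℕ} (hr : r ≠ 0) (hm : Odd m) (ha : a' ≠ 0)
    (hcop : IsCoprime a' (2 ^ k * m)) (hδ : δ = Nat.gcd m r) :
    let d := b ^ 2 - 4 * (r * a') * c
    (Valid (r * a') b c (r * (2 ^ k * m)) ↔
      (¬ IsQuadRes (r * (2 ^ k * m)) d ∨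
        (IsQuadRes (r * (2 ^ k * m)) d ∧
          ExactlyOne (CondI (r * a') b d k m) (CondII b c d r k m δ)
            (CondIII (r * a') b c d r k m δ) (CondIV b c d r k m δ)))) ∧
    MutuallyExclusive (CondI (r * a') b d k m) (CondII b c d r k m δ)
      (CondIII (r * a') b c d r k m δ) (CondIV b c d r k m δ) := by
  intro d
  have ha0 : (r : ℤ) * a' ≠ 0 := mul_ne_zero (by exact_mod_cast hr) ha
  have h23 : ¬ (CondII b c d r k m δ ∧ CondIII (r * a') b c d r k m δ) := fun h => by
    have h1 := h.1.1
    have h2 := h.2.1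
    omega
  have h24 : ¬ (CondII b c d r k m δ ∧ CondIV b c d r k m δ) := fun h => by
    have h1 := h.1.1
    have h2 := h.2.1
    omega
  have h34 : ¬ (CondIII (r * a') b c d r k m δ ∧ CondIV b c d r k m δ) := fun h => by
    have h1 := h.1.1
    have h2 := h.2.1
    omega
  have hlift := cond_iff (b := b) (c := c) hr hm hcop hδ
  have hI : CondI (r * a') b d k m →
      ∀ x : ℤ, ¬ (2 ^ (k - 2) * m : ℤ) ∣ r * a' * x ^ 2 + b * x + c := fun h x =>
    h.not_dvd hm.pos.ne' ha0 x
  have hexcl : CondI (r * a') b d k m → ¬ (CondII b c d r k m δ ∨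
      CondIII (r * a') b c d r k m δ ∨ CondIV b c d r k m δ) := fun h h' => by
    obtain ⟨x, hx⟩ := (hlift.1 h').1
    rw [one_mul] at hx
    exact hI h x hx
  have hvalid : Valid (r * a') b c (r * (2 ^ k * m)) ↔
      ∀ x : ℤ, (2 ^ (k - 2) * m : ℤ) ∣ r * a' * x ^ 2 + b * x + c →
        (r * (2 ^ k * m) : ℤ) ∣ r * a' * x ^ 2 + b * x + c := by
    rw [valid_iff]
    push_cast
    simp only [mul_dvd_four_mul_iff hr hm hcop]
  have hME := mutuallyExclusive_of hexcl h23 h24 h34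
  refine ⟨?_, hME⟩
  rw [hME.exactlyOne_iff]
  by_cases hQ : IsQuadRes (r * (2 ^ k * m)) d
  · simp only [hQ, not_true_eq_false, false_or, true_and]
    by_cases h1 : CondI (r * a') b d k m
    · exact iff_of_true (hvalid.2 fun x hx => absurd hx (hI h1 x)) (Or.inl h1)
    · have h2 := exists_dvd_of_not_condI hr hm ha hcop hQ h1
      rw [or_iff_right h1, hvalid, hlift, Lifts]
      simp only [one_mul]
      exact ⟨fun h => ⟨h2, h⟩, fun h => h.2⟩
  · refine iff_of_true ((valid_iff _ _ _ _).2 fun x hx => ?_) (Or.inl hQ)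
    refine absurd ⟨2 * (r * a') * x + b, (Int.modEq_iff_dvd.2 ?_).symm⟩ hQ
    convert hx using 1
    ring

end IQF

theorem theorem6p1 (a b c d : ℤ) (n r k m δ : ℕ) (hn : 2 ≤ n) (ha : ¬ (n : ℤ) ∣ a)
    (hr : r = Int.gcd a (n : ℤ)) (hk : k = padicValNat 2 (n / r)) (hm : m = n / (2 ^ k * r))
    (hδ : δ = Nat.gcd m r) (hd : d = b ^ 2 - 4 * a * c) :
    (IQF.Valid a b c n ↔
      (¬ IQF.IsQuadRes n d ∨
        (IQF.IsQuadRes n d ∧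
          IQF.ExactlyOne (IQF.CondI a b d k m) (IQF.CondII b c d r k m δ)
            (IQF.CondIII a b c d r k m δ) (IQF.CondIV b c d r k m δ)))) ∧
    IQF.MutuallyExclusive (IQF.CondI a b d k m) (IQF.CondII b c d r k m δ)
      (IQF.CondIII a b c d r k m δ) (IQF.CondIV b c d r k m δ) := by
  have hn0 : n ≠ 0 := by omega
  have ha0 : a ≠ 0 := by rintro rfl; simp at ha
  have hr0 : r ≠ 0 := by
    rw [hr]
    exact fun h => ha0 (Int.gcd_eq_zero_iff.1 h).1
  have hra : (r : ℤ) ∣ a := hr ▸ Int.gcd_dvd_left _ _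
  have hrn : r ∣ n := by
    have : (r : ℤ) ∣ n := hr ▸ Int.gcd_dvd_right _ _
    exact_mod_cast this
  obtain ⟨a', rfl⟩ := hra
  obtain ⟨N, rfl⟩ := hrn
  have hN : N ≠ 0 := by rintro rfl; simp at hn0
  rw [Nat.mul_div_cancel_left _ (Nat.pos_of_ne_zero hr0)] at hk
  obtain ⟨m₀, hm₀, hodd⟩ := IQF.exists_eq_pow_padicValNat_mul Nat.prime_two hN
  rw [← hk] at hm₀
  have hmm : m = m₀ := by
    rw [hm, hm₀, show r * (2 ^ k * m₀) = 2 ^ k * r * m₀ by ring]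
    exact Nat.mul_div_cancel_left _ (by positivity)
  rw [← hmm] at hm₀ hodd
  have hcop : IsCoprime a' (2 ^ k * m) := by
    have h1 : (r : ℤ) ≠ 0 := by exact_mod_cast hr0
    have h2 : IsCoprime a' (N : ℤ) := by
      rw [Int.isCoprime_iff_gcd_eq_one]
      rw [Nat.cast_mul, Int.gcd_mul_left, Int.natAbs_natCast] at hr
      exact (Nat.eq_of_mul_eq_mul_left (Nat.pos_of_ne_zero hr0) ((mul_one r).trans hr)).symm
    rw [hm₀] at h2
    push_cast at h2
    exact h2
  subst hd
  rw [hm₀]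
  exact IQF.valid_iff_cond hr0 (Nat.odd_iff.2 (by omega)) (right_ne_zero_of_mul ha0) hcop hδ
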